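/- For a positive integer $p$ let $J_p=\sum_{k=1}^{p-1}k\cot\left(\frac{k\pi}{p}\right)$ (an empty sum is $0$). Let $b_n$ denote the Bernoulli numbers, defined by $\frac{w}{e^w-1}=\sum_{n\ge0}b_n\frac{w^n}{n!}$, let $\zeta$ be the Riemann zeta function and $\gamma$ Euler's constant. Then for every integer $p\ge1$ the following hold. (a) For every integer $m\ge1$ there is a real number $\varepsilon_{p,m}$ with $0<\varepsilon_{p,m}<|b_{2m}|$ such that $$\pi J_p=-p^2\ln p+(\ln(2\pi)-\gamma)p^2-p-\sum_{k=1}^{m-1}\frac{b_{2k}\,\zeta(2k)}{k\,p^{2k-2}}+(-1)^m\frac{\zeta(2m)}{m\,p^{2m-2}}\,\varepsilon_{p,m}.$$ (b) For every integer $n\ge0$, $$J_p<\frac1\pi\left(-p^2\ln p+(\ln(2\pi)-\gamma)p^2-p\right)+2\pi\sum_{k=1}^{2n}(-1)^k\frac{b_{2k}^2}{k\,(2k)!}\left(\frac{2\pi}{p}\right)^{2k-2}$$ and $$J_p>\frac1\pi\left(-p^2\ln p+(\ln(2\pi)-\gamma)p^2-p\right)+2\pi\sum_{k=1}^{2n+1}(-1)^k\frac{b_{2k}^2}{k\,(2k)!}\left(\frac{2\pi}{p}\right)^{2k-2}.$$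 (c) In particular, $$0<\frac1\pi\left(-p^2\ln p+(\ln(2\pi)-\gamma)p^2-p\right)-J_p<\frac{\pi}{36}.$$ -/

import Mathlib

/-- The sum of cotangents `J_p = ∑_{k=1}^{p-1} k cot(kπ/p)`; it is empty, hence `0`, for `p = 1`. -/
noncomputable def cotSum (p : ℕ) : ℝ :=
  ∑ k ∈ Finset.Ico 1 p, (k : ℝ) * Real.cot ((k : ℝ) * Real.pi / (p : ℝ))

/-- The real number `ζ(s)` at a natural number `s`; it is used only for even `s ≥ 2`, where the
value of Mathlib's complex-valued `riemannZeta` is real. -/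
noncomputable def zetaValue (s : ℕ) : ℝ := (riemannZeta (s : ℂ)).re

/-- For `s ≥ 2`, `zetaValue s` is the sum of the series `∑ 1 / n ^ s`. -/
theorem zetaValue_eq_tsum {s : ℕ} (hs : 1 < s) : zetaValue s = ∑' n : ℕ, 1 / (n : ℝ) ^ s := by
  have h : (∑' n : ℕ, 1 / (n : ℂ) ^ s) = ((∑' n : ℕ, 1 / (n : ℝ) ^ s : ℝ) : ℂ) := by
    push_cast
    rfl
  rw [zetaValue, zeta_nat_eq_tsum_of_gt_one hs, h, Complex.ofReal_re]

/-- The leading part `-p² ln p + (ln(2π) - γ) p² - p` of the expansion of `π J_p`. -/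
noncomputable def cotSumMain (p : ℕ) : ℝ :=
  -(p : ℝ) ^ 2 * Real.log (p : ℝ)
    + (Real.log (2 * Real.pi) - Real.eulerMascheroniConstant) * (p : ℝ) ^ 2 - (p : ℝ)

/-- The truncated expansion
`(1/π)(-p² ln p + (ln(2π) - γ) p² - p) + 2π ∑_{k=1}^{N} (-1)^k b_{2k}² / (k (2k)!) (2π/p)^{2k-2}`. -/
noncomputable def cotSumTruncation (p N : ℕ) : ℝ :=
  1 / Real.pi * cotSumMain p
    + 2 * Real.pi * ∑ k ∈ Finset.Icc 1 N,
        (-1 : ℝ) ^ k * (((bernoulli (2 * k) : ℚ) : ℝ) ^ 2 / ((k : ℝ) * ((2 * k).factorial : ℝ)))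
          * (2 * Real.pi / (p : ℝ)) ^ (2 * k - 2)

/-! Expand each cotangent in partial fractions. The reflection `k ↦ p - k` makes the weighted sum a
combination of differences of harmonic numbers `H_{np}`, and summation by parts followed by
Stirling's formula yields `π J_p = cotSumMain p + 2p² ∑_{n≥1} r(np)`, where `r` is
`harmonicRemainder`.

The Euler–Maclaurin expansion of `r` envelops it: consecutive tails have opposite signs, so each is
smaller in size than the first omitted term. Summing over the multiples of `p` turns `n^(-2k)` into
`ζ(2k) p^(-2k)` and keeps the strict bounds, which is (a). Euler's formula for `ζ(2k)` then gives
(b), and (c) is the case `n = 0`. -/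

open Real Set Filter Topology

/-! ### Bernoulli integrals and their signs -/

/-- The integral `∫₀¹ Bₖ(x) / (a + x)^(k+1) dx` of a Bernoulli polynomial against a power. -/
noncomputable def bernoulliPowIntegral (k : ℕ) (a : ℝ) : ℝ :=
  ∫ x in (0 : ℝ)..1, bernoulliFun k x / (a + x) ^ (k + 1)

theorem intervalIntegrable_div_add_pow {f : ℝ → ℝ} (hf : Continuous f) {a : ℝ} (ha : 0 < a)
    (k : ℕ) : IntervalIntegrable (fun x => f x / (a + x) ^ k) MeasureTheory.volume 0 1 := by
  apply ContinuousOn.intervalIntegrable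
  apply ContinuousOn.div hf.continuousOn (by fun_prop)
  intro x hx
  rw [uIcc_of_le zero_le_one] at hx
  have : 0 < a + x := by linarith [hx.1]
  positivity

theorem hasDerivAt_div_add_pow {f : ℝ → ℝ} {f' a x : ℝ} (hf : HasDerivAt f f' x)
    (hx : 0 < a + x) (k : ℕ) :
    HasDerivAt (fun x => f x / (a + x) ^ (k + 1))
      (f' / (a + x) ^ (k + 1) - (k + 1) * (f x / (a + x) ^ (k + 2))) x := by
  have h1 : HasDerivAt (fun x => (a + x) ^ (k + 1)) ((k + 1) * (a + x) ^ k) x := by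
    simpa using! ((hasDerivAt_id x).const_add a).pow (k + 1)
  have h2 := hf.div h1 (by positivity)
  convert! h2 using 1
  field_simp
  ring

/-- Integration by parts against `1 / (a + x) ^ (k + 1)`. -/
theorem integral_deriv_div_add_pow {f f' : ℝ → ℝ} (hf : ∀ x, HasDerivAt f (f' x) x)
    (hf' : Continuous f') {a : ℝ} (ha : 0 < a) (k : ℕ) :
    ∫ x in (0 : ℝ)..1, f' x / (a + x) ^ (k + 1) =
      f 1 / (a + 1) ^ (k + 1) - f 0 / a ^ (k + 1)
        + (k + 1) * ∫ x in (0 : ℝ)..1, f x / (a + x) ^ (k + 2) := by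
  have hfc : Continuous f := continuous_iff_continuousAt.2 fun x => (hf x).continuousAt
  have i1 := intervalIntegrable_div_add_pow hf' ha (k + 1)
  have i2 := (intervalIntegrable_div_add_pow hfc ha (k + 2)).const_mul ((k : ℝ) + 1)
  have h := intervalIntegral.integral_eq_sub_of_hasDerivAt
    (f := fun x => f x / (a + x) ^ (k + 1))
    (f' := fun x => f' x / (a + x) ^ (k + 1) - (k + 1) * (f x / (a + x) ^ (k + 2)))
    (a := 0) (b := 1) (fun x hx => by
      rw [uIcc_of_le zero_le_one] at hx
      exact hasDerivAt_div_add_pow (hf x) (by linarith [hx.1]) k) (i1.sub i2)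
  rw [intervalIntegral.integral_sub i1 i2, intervalIntegral.integral_const_mul] at h
  simp only [add_zero] at h
  linarith

theorem bernoulliPowIntegral_eq_succ (k : ℕ) {a : ℝ} (ha : 0 < a) :
    bernoulliPowIntegral k a =
      (bernoulliFun (k + 1) 1 / (a + 1) ^ (k + 1) - bernoulliFun (k + 1) 0 / a ^ (k + 1)) / (k + 1)
        + bernoulliPowIntegral (k + 1) a := by
  have hk : (k : ℝ) + 1 ≠ 0 := by positivity
  have h := integral_deriv_div_add_pow (antideriv_bernoulliFun k) (continuous_bernoulliFun k) ha k
  have h2 : ∫ x in (0 : ℝ)..1, bernoulliFun (k + 1) x / (k + 1) / (a + x) ^ (k + 2) =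
      bernoulliPowIntegral (k + 1) a / (k + 1) := by
    rw [bernoulliPowIntegral, ← intervalIntegral.integral_div]
    congr 1
    ext x
    ring
  rw [bernoulliPowIntegral, h, h2]
  field_simp

theorem bernoulliPowIntegral_zero {a : ℝ} (ha : 0 < a) :
    bernoulliPowIntegral 0 a = log (a + 1) - log a := by
  have h := intervalIntegral.integral_eq_sub_of_hasDerivAt
    (f := fun x => log (a + x)) (f' := fun x => bernoulliFun 0 x / (a + x) ^ (0 + 1))
    (a := 0) (b := 1) (fun x hx => by
      rw [uIcc_of_le zero_le_one] at hx
      have : a + x ≠ 0 := by linarith [hx.1]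
      simpa using ((hasDerivAt_id x).const_add a).log this)
    (intervalIntegrable_div_add_pow (continuous_bernoulliFun 0) ha _)
  simpa [bernoulliPowIntegral] using h

theorem bernoulliPowIntegral_one {a : ℝ} (ha : 0 < a) :
    bernoulliPowIntegral 1 a = log (a + 1) - log a - (1 / (a + 1) + 1 / a) / 2 := by
  have h := bernoulliPowIntegral_eq_succ 0 ha
  rw [bernoulliPowIntegral_zero ha] at h
  norm_num at h
  rw [h]
  field_simp
  ring

theorem bernoulliFun_eval_one_of_ne {k : ℕ} (hk : k ≠ 1) :
    bernoulliFun k 1 = (bernoulli k : ℝ) := by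
  rw [bernoulliFun_endpoints_eq_of_ne_one hk, bernoulliFun_eval_zero]

/-- Two integrations by parts; the second has no boundary term because `B_{2m+3} = 0`. -/
theorem bernoulliPowIntegral_odd_step (m : ℕ) {a : ℝ} (ha : 0 < a) :
    bernoulliPowIntegral (2 * m + 1) a =
      (bernoulli (2 * (m + 1)) : ℝ) / (2 * (m + 1 : ℝ)) *
        (1 / (a + 1) ^ (2 * (m + 1)) - 1 / a ^ (2 * (m + 1)))
        + bernoulliPowIntegral (2 * (m + 1) + 1) a := by
  have hz : bernoulli (2 * m + 2 + 1) = 0 := bernoulli_eq_zero_of_odd ⟨m + 1, by ring⟩ (by lia)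
  rw [bernoulliPowIntegral_eq_succ (2 * m + 1) ha, bernoulliPowIntegral_eq_succ (2 * m + 1 + 1) ha,
    bernoulliFun_eval_one_of_ne (by lia), bernoulliFun_eval_one_of_ne (by lia),
    bernoulliFun_eval_zero, bernoulliFun_eval_zero]
  simp only [mul_add, mul_one, add_assoc, Nat.reduceAdd] at hz ⊢
  rw [hz]
  push_cast
  field_simp
  ring

/-- In the Fourier cosine series of `B_{2k}`, the difference of the values at `0` and `x` has
coefficients `(1 - cos 2πnx) / n^(2k) ≥ 0`, strictly positive at `n = 1`. -/
theorem bernoulliFun_even_sub_sign {k : ℕ} (hk : k ≠ 0) {x : ℝ} (hx : x ∈ Ioo (0 : ℝ) 1) :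
    0 < (-1 : ℝ) ^ k * (bernoulliFun (2 * k) x - bernoulli (2 * k)) := by
  have h0 := hasSum_one_div_nat_pow_mul_cos hk (x := 0) ⟨le_rfl, zero_le_one⟩
  have h1 := hasSum_one_div_nat_pow_mul_cos hk (x := x) ⟨hx.1.le, hx.2.le⟩
  have h := h0.sub h1
  change HasSum _ ((-1 : ℝ) ^ (k + 1) * (2 * π) ^ (2 * k) / 2 / (2 * k).factorial *
    bernoulliFun (2 * k) 0 - (-1 : ℝ) ^ (k + 1) * (2 * π) ^ (2 * k) / 2 / (2 * k).factorial *
    bernoulliFun (2 * k) x) at h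
  rw [bernoulliFun_eval_zero] at h
  have hcos : Real.cos (2 * π * x) < 1 := by
    refine lt_of_le_of_ne (cos_le_one _) fun hc => ?_
    have := (Real.cos_eq_one_iff_of_lt_of_lt (by nlinarith [pi_pos, hx.1])
      (by nlinarith [pi_pos, hx.2])).1 hc
    exact (mul_pos two_pi_pos hx.1).ne' this
  have hpos := h.summable.tsum_pos (fun n => ?_) 1 ?_
  · rw [h.tsum_eq] at hpos
    have hc : 0 < (2 * π) ^ (2 * k) / 2 / (2 * k).factorial := by positivity
    refine pos_of_mul_pos_right (a := (2 * π) ^ (2 * k) / 2 / (2 * k).factorial) ?_ hc.le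
    convert! hpos using 1
    ring
  · have : 0 ≤ 1 / (n : ℝ) ^ (2 * k) := by positivity
    simp only [mul_zero, cos_zero, mul_one]
    nlinarith [cos_le_one (2 * π * n * x)]
  · simp
    simpa using hcos

/-- The sign of the Euler–Maclaurin remainder. -/
theorem bernoulliPowIntegral_odd_sign (m : ℕ) {a : ℝ} (ha : 0 < a) :
    0 < (-1 : ℝ) ^ (m + 1) * bernoulliPowIntegral (2 * m + 1) a := by
  have hk : (2 * (m : ℝ) + 2) ≠ 0 := by positivity
  -- This antiderivative vanishes at both endpoints, so integration by parts leaves only an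
  -- integrand of constant sign.
  have hd : ∀ x, HasDerivAt (fun x => (-1 : ℝ) ^ (m + 1) *
      (bernoulliFun (2 * (m + 1)) x - bernoulli (2 * (m + 1))))
      ((-1 : ℝ) ^ (m + 1) * ((2 * m + 2) * bernoulliFun (2 * m + 1) x)) x := fun x => by
    have := ((hasDerivAt_bernoulliFun (2 * (m + 1)) x).sub_const
      (bernoulli (2 * (m + 1)) : ℝ)).const_mul ((-1 : ℝ) ^ (m + 1))
    convert! this using 3
    push_cast
    ring
  have hcont := continuous_bernoulliFun (2 * m + 1)
  have h := integral_deriv_div_add_pow hd (by fun_prop) ha (2 * m + 1)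
  rw [bernoulliFun_eval_one_of_ne (by lia), bernoulliFun_eval_zero] at h
  simp only [sub_self, mul_zero, zero_div, zero_add] at h
  have h2 : ∫ x in (0 : ℝ)..1, (-1 : ℝ) ^ (m + 1) * ((2 * m + 2) * bernoulliFun (2 * m + 1) x) /
      (a + x) ^ (2 * m + 1 + 1) =
      (2 * m + 2) * ((-1 : ℝ) ^ (m + 1) * bernoulliPowIntegral (2 * m + 1) a) := by
    rw [bernoulliPowIntegral, ← intervalIntegral.integral_const_mul,
      ← intervalIntegral.integral_const_mul]
    congr 1
    ext x
    ring
  rw [h2] at h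
  have hpos : 0 < ∫ x in (0 : ℝ)..1, (-1 : ℝ) ^ (m + 1) *
      (bernoulliFun (2 * (m + 1)) x - bernoulli (2 * (m + 1))) / (a + x) ^ (2 * m + 1 + 2) := by
    apply intervalIntegral.intervalIntegral_pos_of_pos_on _ _ zero_lt_one
    · have := continuous_bernoulliFun (2 * (m + 1))
      exact intervalIntegrable_div_add_pow (by fun_prop) ha _
    · intro x hx
      have : 0 < a + x := by linarith [hx.1]
      exact div_pos (bernoulliFun_even_sub_sign (Nat.succ_ne_zero m) hx) (by positivity)
  refine pos_of_mul_pos_right (a := 2 * (m : ℝ) + 2) ?_ (by positivity)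
  rw [h]
  positivity

/-! ### Enveloping expansion of the harmonic numbers -/

/-- The remainder `H_n - ln n - γ - 1/(2n)` in the expansion of the harmonic numbers. -/
noncomputable def harmonicRemainder (n : ℕ) : ℝ :=
  (harmonic n : ℝ) - log n - eulerMascheroniConstant - 1 / (2 * n)

/-- The remainder after the first `m` Bernoulli terms in the expansion of the harmonic numbers. -/
noncomputable def harmonicRemainderTail (m n : ℕ) : ℝ :=
  harmonicRemainder n +
    ∑ k ∈ Finset.Ico 1 (m + 1), (bernoulli (2 * k) : ℝ) / (2 * k * (n : ℝ) ^ (2 * k))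

theorem harmonicRemainderTail_succ (m n : ℕ) :
    harmonicRemainderTail (m + 1) n = harmonicRemainderTail m n +
      (bernoulli (2 * (m + 1)) : ℝ) / (2 * (m + 1 : ℝ) * (n : ℝ) ^ (2 * (m + 1))) := by
  rw [harmonicRemainderTail, Finset.sum_Ico_succ_top (by lia), harmonicRemainderTail]
  push_cast
  ring

theorem harmonicRemainderTail_sub_succ (m : ℕ) {n : ℕ} (hn : 0 < n) :
    harmonicRemainderTail m n - harmonicRemainderTail m (n + 1) =
      bernoulliPowIntegral (2 * m + 1) n := by
  have hn' : (0 : ℝ) < n := Nat.cast_pos.2 hn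
  induction m with
  | zero =>
    simp only [harmonicRemainderTail, harmonicRemainder, zero_add, Finset.Ico_self,
      Finset.sum_empty, mul_zero, bernoulliPowIntegral_one hn', harmonic_succ]
    push_cast
    field_simp
    ring
  | succ m ih =>
    rw [harmonicRemainderTail_succ, harmonicRemainderTail_succ]
    rw [bernoulliPowIntegral_odd_step m hn'] at ih
    push_cast
    have e : ∀ y : ℝ, (bernoulli (2 * (m + 1)) : ℝ) / (2 * (m + 1 : ℝ) * y) =
      (bernoulli (2 * (m + 1)) : ℝ) / (2 * (m + 1 : ℝ)) * (1 / y) := fun y => by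
        rw [div_mul_div_comm, mul_one]
    rw [e, e]
    linarith

theorem tendsto_harmonicRemainder : Tendsto harmonicRemainder atTop (𝓝 0) := by
  have h1 := (tendsto_harmonic_sub_log.sub_const eulerMascheroniConstant).sub
    (tendsto_const_div_atTop_nhds_zero_nat (1 / 2 : ℝ))
  simp only [sub_self] at h1
  refine h1.congr fun n => ?_
  rw [harmonicRemainder, div_div]

theorem tendsto_harmonicRemainderTail (m : ℕ) : Tendsto (harmonicRemainderTail m) atTop (𝓝 0) := by
  induction m with
  | zero =>
    convert! tendsto_harmonicRemainder using 1
    ext n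
    simp [harmonicRemainderTail]
  | succ m ih =>
    have h := ih.add ((tendsto_const_nhds (x := (bernoulli (2 * (m + 1)) : ℝ) /
      (2 * (m + 1 : ℝ)))).div_atTop ((tendsto_pow_atTop (α := ℝ) (n := 2 * (m + 1)) (by lia)).comp
        tendsto_natCast_atTop_atTop))
    rw [add_zero] at h
    refine h.congr fun n => ?_
    rw [harmonicRemainderTail_succ, div_div]
    rfl

/-- The signed tails decrease strictly, since their differences are signed Bernoulli integrals, and
they tend to `0`. -/
theorem harmonicRemainderTail_sign (m : ℕ) {n : ℕ} (hn : 0 < n) :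
    0 < (-1 : ℝ) ^ (m + 1) * harmonicRemainderTail m n := by
  have hstep : ∀ j, (-1 : ℝ) ^ (m + 1) * harmonicRemainderTail m (n + (j + 1)) <
      (-1 : ℝ) ^ (m + 1) * harmonicRemainderTail m (n + j) := fun j => by
    have h1 := harmonicRemainderTail_sub_succ m (n := n + j) (by lia)
    have h2 := bernoulliPowIntegral_odd_sign m (a := ((n + j : ℕ) : ℝ)) (Nat.cast_pos.2 (by lia))
    rw [← h1, add_assoc] at h2
    linarith
  have hanti : StrictAnti fun j => (-1 : ℝ) ^ (m + 1) * harmonicRemainderTail m (n + j) :=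
    strictAnti_nat_of_succ_lt hstep
  have hlim : Tendsto (fun j => (-1 : ℝ) ^ (m + 1) * harmonicRemainderTail m (n + j)) atTop
      (𝓝 0) := by
    have := ((tendsto_add_atTop_iff_nat n).2 (tendsto_harmonicRemainderTail m)).const_mul
      ((-1 : ℝ) ^ (m + 1))
    rw [mul_zero] at this
    exact this.congr fun j => by rw [add_comm j n]
  -- Comparing the limit with index `1` leaves one strict step down from index `0`.
  exact (hanti.antitone.le_of_tendsto hlim 1).trans_lt (hstep 0)

/-- The Bernoulli expansion of the harmonic numbers is enveloping. -/
theorem harmonicRemainderTail_lt (m : ℕ) {n : ℕ} (hn : 0 < n) :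
    (-1 : ℝ) ^ (m + 1) * harmonicRemainderTail m n <
      (-1 : ℝ) ^ m * (bernoulli (2 * (m + 1)) : ℝ) / (2 * (m + 1 : ℝ) * (n : ℝ) ^ (2 * (m + 1))) := by
  have h := harmonicRemainderTail_sign (m + 1) hn
  rw [harmonicRemainderTail_succ, pow_succ, pow_succ] at h
  rw [pow_succ, mul_div_assoc]
  linarith

/-! ### From cotangents to harmonic numbers -/

theorem tendsto_sum_cot {x : ℝ} (hx : x ∈ Ioo (0 : ℝ) 1) :
    Tendsto (fun N : ℕ => ∑ n ∈ Finset.range N, (1 / (x + n) - 1 / (n + 1 - x))) atTop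
      (𝓝 (π * Real.cot (π * x))) := by
  have hxc : (x : ℂ) ∈ Complex.integerComplement := by
    rintro ⟨n, hn⟩
    have hn' : (n : ℝ) = x := by exact_mod_cast hn
    rw [← hn'] at hx
    have h1 : (0 : ℤ) < n := by exact_mod_cast hx.1
    have h2 : n < (1 : ℤ) := by exact_mod_cast hx.2
    lia
  have h := tendsto_logDeriv_euler_cot_sub hxc
  have hr : Tendsto (fun N : ℕ => ∑ n ∈ Finset.range N,
      (1 / (x - (n + 1)) + 1 / (x + (n + 1)))) atTop (𝓝 (π * Real.cot (π * x) - 1 / x)) := by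
    have h' := (Complex.continuous_re.tendsto _).comp h
    convert! h' using 2 with N
    · simp only [Function.comp_apply, cotTerm]
      rw [← Complex.ofReal_re (∑ n ∈ Finset.range N, (1 / (x - (n + 1)) + 1 / (x + (n + 1))))]
      push_cast
      rfl
    · rw [← Complex.ofReal_re (π * Real.cot (π * x) - 1 / x)]
      push_cast
      rfl
  -- Regrouping the symmetric partial sums shifts the terms `1 / (x + n)` by one and leaves this
  -- boundary term.
  have hz : Tendsto (fun N : ℕ => 1 / (x + N)) atTop (𝓝 0) :=
    tendsto_const_nhds.div_atTop (tendsto_atTop_add_const_left _ x tendsto_natCast_atTop_atTop)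
  have h2 := (hr.add_const (1 / x)).sub hz
  rw [sub_add_cancel, sub_zero] at h2
  refine h2.congr fun N => ?_
  induction N with
  | zero => simp
  | succ N ih =>
    rw [Finset.sum_range_succ, Finset.sum_range_succ, ← ih,
      show (x - ((N : ℝ) + 1)) = -((N : ℝ) + 1 - x) by ring, div_neg]
    push_cast
    ring

theorem harmonic_add_sub (m q : ℕ) :
    ((harmonic (m + q) : ℚ) : ℝ) - (harmonic m : ℚ) =
      ∑ k ∈ Finset.Ico 1 (q + 1), 1 / ((m : ℝ) + k) := by
  induction q with
  | zero => simp
  | succ q ih =>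
    rw [Finset.sum_Ico_succ_top (by lia), ← ih, ← add_assoc, harmonic_succ]
    push_cast
    ring

/-- After reflecting the second fractions, both have denominator `np + k`, with `p(2k - p)/(np + k)
= 2p - (2n + 1)p²/(np + k)`. -/
theorem sum_mul_cot_summand {p : ℕ} (hp : 1 ≤ p) (n : ℕ) :
    ∑ k ∈ Finset.Ico 1 p, (k : ℝ) * (1 / ((k : ℝ) / p + n) - 1 / (n + 1 - (k : ℝ) / p)) =
      2 * p * (p - 1) - (2 * n + 1) * p ^ 2 *
        ((harmonic ((n + 1) * p) : ℚ) - (harmonic (n * p) : ℚ) - 1 / ((n + 1) * p)) := by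
  have hp0 : (0 : ℝ) < p := by exact_mod_cast hp
  have h1 : ∑ k ∈ Finset.Ico 1 p, (k : ℝ) * (1 / (n + 1 - (k : ℝ) / p)) =
      ∑ k ∈ Finset.Ico 1 p, ((p : ℝ) - k) * (p / (n * p + k)) := by
    have := Finset.sum_Ico_reflect (fun j : ℕ => (j : ℝ) * (1 / (n + 1 - (j : ℝ) / p))) 1
      (Nat.le_succ p)
    rw [Nat.add_sub_cancel_left, Nat.add_sub_cancel] at this
    rw [← this]
    refine Finset.sum_congr rfl fun k hk => ?_
    rw [Finset.mem_Ico] at hk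
    have hk0 : (0 : ℝ) < k := by exact_mod_cast hk.1
    rw [Nat.cast_sub hk.2.le]
    congr 1
    rw [show (n : ℝ) + 1 - ((p : ℝ) - k) / p = (n * p + k) / p by field_simp; ring, one_div_div]
  have h2 : ((harmonic ((n + 1) * p) : ℚ) : ℝ) - (harmonic (n * p) : ℚ) - 1 / ((n + 1) * p) =
      ∑ k ∈ Finset.Ico 1 p, 1 / ((n : ℝ) * p + k) := by
    have := harmonic_add_sub (n * p) p
    rw [Finset.sum_Ico_succ_top hp] at this
    rw [show (n + 1) * p = n * p + p by ring, this]
    push_cast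
    ring
  rw [h2]
  simp only [mul_sub]
  rw [Finset.sum_sub_distrib, h1, Finset.mul_sum, ← Finset.sum_sub_distrib]
  have h3 : 2 * (p : ℝ) * p - 2 * p * 1 = ∑ k ∈ Finset.Ico 1 p, 2 * (p : ℝ) := by
    rw [Finset.sum_const, Nat.card_Ico, nsmul_eq_mul, Nat.cast_sub hp]
    push_cast
    ring
  rw [h3, ← Finset.sum_sub_distrib]
  refine Finset.sum_congr rfl fun k hk => ?_
  rw [Finset.mem_Ico] at hk
  have hk0 : (0 : ℝ) < k := by exact_mod_cast hk.1
  have h4 : (0 : ℝ) < n * p + k := by positivity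
  rw [show (k : ℝ) / p + n = (n * p + k) / p by field_simp; ring, one_div_div]
  field_simp
  ring

theorem sum_sum_mul_cot_summand {p : ℕ} (hp : 1 ≤ p) (N : ℕ) :
    ∑ k ∈ Finset.Ico 1 p, (k : ℝ) * ∑ n ∈ Finset.range N,
        (1 / ((k : ℝ) / p + n) - 1 / (n + 1 - (k : ℝ) / p)) =
      2 * p ^ 2 * N - p * (harmonic N : ℚ) - p ^ 2 * ((2 * N + 1) * (harmonic (N * p) : ℚ)
        - 2 * ∑ n ∈ Finset.range N, ((harmonic ((n + 1) * p) : ℚ) : ℝ)) := by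
  have hp0 : (0 : ℝ) < p := by exact_mod_cast hp
  simp only [Finset.mul_sum]
  rw [Finset.sum_comm]
  simp only [sum_mul_cot_summand hp]
  induction N with
  | zero => simp
  | succ N ih =>
    simp only [← Finset.mul_sum] at ih ⊢
    rw [Finset.sum_range_succ, Finset.sum_range_succ, ih, harmonic_succ]
    push_cast
    field_simp
    ring

/-! ### Asymptotics of the partial sums -/

theorem harmonic_eq_remainder {n p : ℕ} (hn : 0 < n) (hp : 0 < p) :
    ((harmonic (n * p) : ℚ) : ℝ) = harmonicRemainder (n * p) + log n + log p
      + eulerMascheroniConstant + 1 / (2 * (n * p)) := by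
  have hn0 : (n : ℝ) ≠ 0 := by exact_mod_cast hn.ne'
  have hp0 : (p : ℝ) ≠ 0 := by exact_mod_cast hp.ne'
  rw [harmonicRemainder, Nat.cast_mul, log_mul hn0 hp0]
  ring

theorem sum_harmonic_eq {p : ℕ} (hp : 0 < p) (N : ℕ) :
    ∑ n ∈ Finset.range N, ((harmonic ((n + 1) * p) : ℚ) : ℝ) =
      ∑ n ∈ Finset.range N, harmonicRemainder ((n + 1) * p) + log N.factorial
        + N * (log p + eulerMascheroniConstant) + (harmonic N : ℚ) / (2 * p) := by
  have hp0 : (p : ℝ) ≠ 0 := by exact_mod_cast hp.ne'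
  induction N with
  | zero => simp
  | succ N ih =>
    rw [Finset.sum_range_succ, Finset.sum_range_succ, ih, harmonic_eq_remainder N.succ_pos hp,
      Nat.factorial_succ, Nat.cast_mul, log_mul (by positivity) (by positivity), harmonic_succ]
    push_cast
    field_simp
    ring

theorem tendsto_log_factorial_sub :
    Tendsto (fun N : ℕ => log N.factorial - (N + 1 / 2) * log N + N) atTop
      (𝓝 (log (2 * π) / 2)) := by
  have h := (Stirling.tendsto_stirlingSeq_sqrt_pi.log (by positivity)).add_const (log 2 / 2)
  rw [show log √π + log 2 / 2 = log (2 * π) / 2 by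
    rw [log_sqrt pi_pos.le, log_mul two_ne_zero pi_ne_zero]; ring] at h
  refine h.congr' ?_
  filter_upwards [eventually_gt_atTop 0] with N hN
  have hN0 : (N : ℝ) ≠ 0 := by exact_mod_cast hN.ne'
  rw [Stirling.log_stirlingSeq_formula, log_mul two_ne_zero hN0, log_div hN0 (exp_ne_zero 1),
    log_exp]
  ring

theorem abs_harmonicRemainder_le {n : ℕ} (hn : 0 < n) :
    |harmonicRemainder n| ≤ 1 / (12 * (n : ℝ) ^ 2) := by
  have h0 := harmonicRemainderTail_sign 0 hn
  have h1 := harmonicRemainderTail_lt 0 hn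
  have e : harmonicRemainderTail 0 n = harmonicRemainder n := by simp [harmonicRemainderTail]
  rw [e] at h0 h1
  norm_num [bernoulli_two] at h0 h1
  rw [abs_of_neg h0]
  refine h1.le.trans_eq ?_
  field_simp
  norm_num

theorem summable_harmonicRemainder {p : ℕ} (hp : 0 < p) :
    Summable fun n : ℕ => harmonicRemainder ((n + 1) * p) := by
  have hs : Summable fun n : ℕ => 1 / ((n + 1 : ℕ) : ℝ) ^ 2 :=
    (summable_nat_add_iff 1).2 (summable_one_div_nat_pow.2 one_lt_two)
  refine Summable.of_norm_bounded hs fun n => ?_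
  rw [norm_eq_abs]
  refine (abs_harmonicRemainder_le (by positivity)).trans ?_
  have hp1 : (1 : ℝ) ≤ p := by exact_mod_cast hp
  have hn : (0 : ℝ) < (n + 1 : ℕ) := by positivity
  push_cast at hn ⊢
  apply one_div_le_one_div_of_le (by positivity)
  nlinarith [mul_le_mul_of_nonneg_left hp1 hn.le]

theorem tendsto_mul_harmonicRemainder {p : ℕ} (hp : 0 < p) :
    Tendsto (fun N : ℕ => (2 * N + 1 : ℝ) * harmonicRemainder (N * p)) atTop (𝓝 0) := by
  refine squeeze_zero_norm' ?_ (tendsto_one_div_atTop_nhds_zero_nat (𝕜 := ℝ))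
  filter_upwards [eventually_gt_atTop 0] with N hN
  have hN1 : (1 : ℝ) ≤ N := by exact_mod_cast hN
  have hp1 : (1 : ℝ) ≤ p := by exact_mod_cast hp
  rw [norm_mul, norm_eq_abs, norm_eq_abs, abs_of_pos (by positivity)]
  refine (mul_le_mul_of_nonneg_left (abs_harmonicRemainder_le (by positivity))
    (by positivity)).trans ?_
  rw [mul_one_div, div_le_div_iff₀ (by positivity) (by positivity)]
  push_cast
  have : (N : ℝ) ^ 2 ≤ (N * p) ^ 2 := by
    gcongr
    exact le_mul_of_one_le_right (by positivity) hp1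
  nlinarith

/-- The cotangent sum in terms of the remainders of the harmonic numbers `H_p, H_{2p}, …`. -/
theorem pi_mul_cotSum_eq {p : ℕ} (hp : 1 ≤ p) :
    π * cotSum p = cotSumMain p + 2 * p ^ 2 * ∑' n : ℕ, harmonicRemainder ((n + 1) * p) := by
  have hp0 : (0 : ℝ) < p := by exact_mod_cast hp
  have hL : Tendsto (fun N : ℕ => ∑ k ∈ Finset.Ico 1 p, (k : ℝ) * ∑ n ∈ Finset.range N,
      (1 / ((k : ℝ) / p + n) - 1 / (n + 1 - (k : ℝ) / p))) atTop (𝓝 (π * cotSum p)) := by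
    rw [cotSum, Finset.mul_sum]
    refine tendsto_finsetSum _ fun k hk => ?_
    rw [Finset.mem_Ico] at hk
    have hk0 : (0 : ℝ) < k := by exact_mod_cast hk.1
    have hkp : (k : ℝ) < p := by exact_mod_cast hk.2
    have h := (tendsto_sum_cot (x := (k : ℝ) / p)
      ⟨by positivity, (div_lt_one hp0).2 hkp⟩).const_mul (k : ℝ)
    convert! h using 2
    rw [show (k : ℝ) * π / p = π * (k / p) by ring]
    ring
  refine tendsto_nhds_unique hL ?_
  have hS := (summable_harmonicRemainder hp).hasSum.tendsto_sum_nat.const_mul (2 * (p : ℝ) ^ 2)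
  have hF := (tendsto_log_factorial_sub.sub_const (log (2 * π) / 2)).const_mul (2 * (p : ℝ) ^ 2)
  have hR := (tendsto_mul_harmonicRemainder hp).const_mul ((p : ℝ) ^ 2)
  -- The terms in `H_N` cancel; the `1/(2Np)` part of `H_{Np}` contributes `-p` and this vanishing
  -- `p/(2N)`.
  have hI := tendsto_const_div_atTop_nhds_zero_nat ((p : ℝ) / 2)
  have h := (((hS.const_add (cotSumMain p)).add hF).sub hR).sub hI
  rw [sub_self, mul_zero, mul_zero, add_zero, sub_zero, sub_zero] at h
  refine h.congr' ?_
  filter_upwards [eventually_gt_atTop 0] with N hN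
  have hN0 : (0 : ℝ) < N := by exact_mod_cast hN
  rw [sum_sum_mul_cot_summand hp, sum_harmonic_eq hp, harmonic_eq_remainder hN hp, cotSumMain]
  field_simp
  ring

/-! ### Zeta values and the summed expansion -/

/-- Enveloping at `n = 1` places a positive number below a positive multiple of the left side. -/
theorem bernoulli_even_sign (m : ℕ) :
    (-1 : ℝ) ^ m * (bernoulli (2 * (m + 1)) : ℝ) = |(bernoulli (2 * (m + 1)) : ℝ)| := by
  have h := (harmonicRemainderTail_sign m one_pos).trans (harmonicRemainderTail_lt m one_pos)
  have h2 : 0 < (-1 : ℝ) ^ m * (bernoulli (2 * (m + 1)) : ℝ) := by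
    by_contra hc
    exact absurd h (not_lt.2 (div_nonpos_of_nonpos_of_nonneg (not_lt.1 hc) (by positivity)))
  rw [← abs_of_pos h2, abs_mul, abs_neg_one_pow, one_mul]

theorem hasSum_zetaValue_succ {s : ℕ} (hs : 1 < s) :
    HasSum (fun n : ℕ => 1 / ((n + 1 : ℕ) : ℝ) ^ s) (zetaValue s) := by
  have h := (summable_one_div_nat_pow.2 hs).hasSum
  rw [← zetaValue_eq_tsum hs] at h
  have := (hasSum_nat_add_iff' 1).2 h
  simpa [zero_pow (by lia : s ≠ 0)] using this

theorem zetaValue_pos {s : ℕ} (hs : 1 < s) : 0 < zetaValue s := by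
  have h := hasSum_zetaValue_succ hs
  rw [← h.tsum_eq]
  exact h.summable.tsum_pos (fun n => by positivity) 0 (by positivity)

theorem zetaValue_two_mul {k : ℕ} (hk : k ≠ 0) :
    zetaValue (2 * k) =
      (-1 : ℝ) ^ (k + 1) * 2 ^ (2 * k - 1) * π ^ (2 * k) * bernoulli (2 * k) /
        (2 * k).factorial := by
  rw [zetaValue_eq_tsum (by lia)]
  exact (hasSum_zeta_nat hk).tsum_eq

theorem hasSum_bernoulli_term (p m : ℕ) :
    HasSum (fun n : ℕ => (bernoulli (2 * (m + 1)) : ℝ) /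
        (2 * (m + 1 : ℝ) * (((n + 1) * p : ℕ) : ℝ) ^ (2 * (m + 1))))
      ((bernoulli (2 * (m + 1)) : ℝ) * zetaValue (2 * (m + 1)) /
        (2 * (m + 1 : ℝ) * (p : ℝ) ^ (2 * (m + 1)))) := by
  have h := (hasSum_zetaValue_succ (s := 2 * (m + 1)) (by lia)).mul_left
    ((bernoulli (2 * (m + 1)) : ℝ) / (2 * (m + 1 : ℝ) * (p : ℝ) ^ (2 * (m + 1))))
  convert! h using 1
  · ext n
    rw [Nat.cast_mul, mul_pow, div_mul_div_comm, mul_one]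
    congr 1
    ring
  · ring

theorem hasSum_harmonicRemainderTail {p : ℕ} (hp : 1 ≤ p) (m : ℕ) :
    HasSum (fun n : ℕ => harmonicRemainderTail m ((n + 1) * p))
      (∑' n : ℕ, harmonicRemainder ((n + 1) * p) + ∑ k ∈ Finset.Ico 1 (m + 1),
        (bernoulli (2 * k) : ℝ) * zetaValue (2 * k) / (2 * k * (p : ℝ) ^ (2 * k))) := by
  induction m with
  | zero => simpa [harmonicRemainderTail] using (summable_harmonicRemainder hp).hasSum
  | succ m ih =>
    have h := ih.add (hasSum_bernoulli_term p m)
    rw [Finset.sum_Ico_succ_top (by lia), ← add_assoc]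
    push_cast
    refine h.congr_fun fun n => ?_
    rw [harmonicRemainderTail_succ]

theorem pow_two_mul_eq_sq_mul {k : ℕ} (hk : 1 ≤ k) (x : ℝ) :
    x ^ (2 * k) = x ^ 2 * x ^ (2 * k - 2) := by
  rw [← pow_add]
  congr 1
  lia

/-- The expansion of the cotangent sum with an enveloping remainder. -/
theorem pi_mul_cotSum_expansion {p : ℕ} (hp : 1 ≤ p) {m : ℕ} (hm : 1 ≤ m) :
    ∃ ε : ℝ, 0 < ε ∧ ε < |((bernoulli (2 * m) : ℚ) : ℝ)| ∧
      Real.pi * cotSum p = cotSumMain p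
        - ∑ k ∈ Finset.Ico 1 m,
            ((bernoulli (2 * k) : ℚ) : ℝ) * zetaValue (2 * k) / ((k : ℝ) * (p : ℝ) ^ (2 * k - 2))
        + (-1 : ℝ) ^ m * (zetaValue (2 * m) / ((m : ℝ) * (p : ℝ) ^ (2 * m - 2))) * ε := by
  obtain ⟨M, rfl⟩ : ∃ M, m = M + 1 := ⟨m - 1, by lia⟩
  have hp0 : (0 : ℝ) < p := by exact_mod_cast hp
  have hz := zetaValue_pos (s := 2 * (M + 1)) (by lia)
  have hT := hasSum_harmonicRemainderTail hp M
  set T := ∑' n : ℕ, harmonicRemainder ((n + 1) * p) + ∑ k ∈ Finset.Ico 1 (M + 1),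
        (bernoulli (2 * k) : ℝ) * zetaValue (2 * k) / (2 * k * (p : ℝ) ^ (2 * k)) with hTdef
  have hT' := hT.mul_left ((-1 : ℝ) ^ (M + 1))
  have hB := (hasSum_bernoulli_term p M).mul_left ((-1 : ℝ) ^ M)
  have hpos : 0 < (-1 : ℝ) ^ (M + 1) * T := by
    rw [← hT'.tsum_eq]
    exact hT'.summable.tsum_pos (fun n => (harmonicRemainderTail_sign M (by positivity)).le) 0
      (harmonicRemainderTail_sign M (by positivity))
  have hlt : (-1 : ℝ) ^ (M + 1) * T < |(bernoulli (2 * (M + 1)) : ℝ)| *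
      zetaValue (2 * (M + 1)) / (2 * (M + 1 : ℝ) * (p : ℝ) ^ (2 * (M + 1))) := by
    rw [← bernoulli_even_sign, mul_assoc, mul_div_assoc]
    have hterm : ∀ n : ℕ, (-1 : ℝ) ^ (M + 1) * harmonicRemainderTail M ((n + 1) * p) <
        (-1 : ℝ) ^ M * ((bernoulli (2 * (M + 1)) : ℝ) /
          (2 * (M + 1 : ℝ) * (((n + 1) * p : ℕ) : ℝ) ^ (2 * (M + 1)))) := fun n => by
      rw [← mul_div_assoc]
      exact harmonicRemainderTail_lt M (by positivity)
    exact hasSum_lt (fun n => (hterm n).le) (hterm 0) hT' hB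
  have hc : 0 < 2 * (M + 1 : ℝ) * (p : ℝ) ^ (2 * (M + 1)) / zetaValue (2 * (M + 1)) := by
    positivity
  -- `ε` is the signed total tail divided by the coefficient of `|b_{2m}|` in its upper bound.
  refine ⟨2 * (M + 1 : ℝ) * (p : ℝ) ^ (2 * (M + 1)) / zetaValue (2 * (M + 1)) *
    ((-1 : ℝ) ^ (M + 1) * T), by positivity, ?_, ?_⟩
  · refine (mul_lt_mul_of_pos_left hlt hc).trans_eq ?_
    field_simp
  · have hsum : ∑ k ∈ Finset.Ico 1 (M + 1),
        ((bernoulli (2 * k) : ℚ) : ℝ) * zetaValue (2 * k) / ((k : ℝ) * (p : ℝ) ^ (2 * k - 2)) =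
        2 * p ^ 2 * ∑ k ∈ Finset.Ico 1 (M + 1),
        (bernoulli (2 * k) : ℝ) * zetaValue (2 * k) / (2 * k * (p : ℝ) ^ (2 * k)) := by
      rw [Finset.mul_sum]
      refine Finset.sum_congr rfl fun k hk => ?_
      have hk1 := (Finset.mem_Ico.1 hk).1
      have hk0 : (k : ℝ) ≠ 0 := by positivity
      rw [pow_two_mul_eq_sq_mul hk1]
      field_simp
    have hsign : (-1 : ℝ) ^ (M + 1) * (-1 : ℝ) ^ (M + 1) = 1 := by
      rw [← mul_pow]; simp
    have hrem : (-1 : ℝ) ^ (M + 1) *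
        (zetaValue (2 * (M + 1)) / (((M + 1 : ℕ) : ℝ) * (p : ℝ) ^ (2 * (M + 1) - 2))) *
        (2 * (M + 1 : ℝ) * (p : ℝ) ^ (2 * (M + 1)) / zetaValue (2 * (M + 1)) *
          ((-1 : ℝ) ^ (M + 1) * T)) = 2 * p ^ 2 * T := by
      rw [pow_two_mul_eq_sq_mul (k := M + 1) (by lia) (p : ℝ)]
      push_cast
      field_simp
      linear_combination T * hsign
    rw [hrem, hsum, hTdef, pi_mul_cotSum_eq hp]
    ring

/-! ### Truncation bounds -/

theorem cotSumTruncation_eq {p : ℕ} (hp : 1 ≤ p) (N : ℕ) :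
    cotSumTruncation p N = 1 / π * (cotSumMain p - ∑ k ∈ Finset.Ico 1 (N + 1),
      ((bernoulli (2 * k) : ℚ) : ℝ) * zetaValue (2 * k) / ((k : ℝ) * (p : ℝ) ^ (2 * k - 2))) := by
  have hp0 : (0 : ℝ) < p := by exact_mod_cast hp
  rw [cotSumTruncation, mul_sub, sub_eq_add_neg, ← mul_neg, ← Finset.sum_neg_distrib,
    Finset.mul_sum, Finset.mul_sum, Finset.Ico_add_one_right_eq_Icc]
  congr 1
  refine Finset.sum_congr rfl fun k hk => ?_
  have hk1 := (Finset.mem_Icc.1 hk).1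
  have hk0 : (k : ℝ) ≠ 0 := by positivity
  have h2 : (2 : ℝ) ^ (2 * k - 1) = 2 * 2 ^ (2 * k - 2) := by
    rw [← pow_succ']
    congr 1
    lia
  rw [zetaValue_two_mul (by lia), pow_two_mul_eq_sq_mul hk1 π, h2, div_pow, mul_pow]
  field_simp
  ring

theorem cotSum_sub_cotSumTruncation_sign {p : ℕ} (hp : 1 ≤ p) (N : ℕ) :
    0 < (-1 : ℝ) ^ (N + 1) * (cotSum p - cotSumTruncation p N) := by
  obtain ⟨ε, hε, -, h⟩ := pi_mul_cotSum_expansion hp (m := N + 1) (by lia)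
  have hp0 : (0 : ℝ) < p := by exact_mod_cast hp
  have hz := zetaValue_pos (s := 2 * (N + 1)) (by lia)
  have hsign : (-1 : ℝ) ^ (N + 1) * (-1 : ℝ) ^ (N + 1) = 1 := by
    rw [← mul_pow]; simp
  have hJ : cotSum p = 1 / π * (π * cotSum p) := by field_simp
  have key : (-1 : ℝ) ^ (N + 1) * (cotSum p - cotSumTruncation p N) =
      1 / π * (zetaValue (2 * (N + 1)) / (((N + 1 : ℕ) : ℝ) * (p : ℝ) ^ (2 * (N + 1) - 2)) * ε) := by
    rw [hJ, h, cotSumTruncation_eq hp]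
    linear_combination 1 / π *
      (zetaValue (2 * (N + 1)) / (((N + 1 : ℕ) : ℝ) * (p : ℝ) ^ (2 * (N + 1) - 2)) * ε) * hsign
  rw [key]
  positivity

theorem corollary9p8 (p : ℕ) (hp : 1 ≤ p) :
    (∀ m : ℕ, 1 ≤ m → ∃ ε : ℝ, 0 < ε ∧ ε < |((bernoulli (2 * m) : ℚ) : ℝ)| ∧
      Real.pi * cotSum p = cotSumMain p
        - ∑ k ∈ Finset.Ico 1 m,
            ((bernoulli (2 * k) : ℚ) : ℝ) * zetaValue (2 * k) / ((k : ℝ) * (p : ℝ) ^ (2 * k - 2))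
        + (-1 : ℝ) ^ m * (zetaValue (2 * m) / ((m : ℝ) * (p : ℝ) ^ (2 * m - 2))) * ε) ∧
    (∀ n : ℕ, cotSum p < cotSumTruncation p (2 * n) ∧
      cotSumTruncation p (2 * n + 1) < cotSum p) ∧
    (0 < 1 / Real.pi * cotSumMain p - cotSum p ∧
      1 / Real.pi * cotSumMain p - cotSum p < Real.pi / 36) := by
  have hb : ∀ n : ℕ, cotSum p < cotSumTruncation p (2 * n) ∧
      cotSumTruncation p (2 * n + 1) < cotSum p := fun n => by
    have h0 := cotSum_sub_cotSumTruncation_sign hp (2 * n)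
    have h1 := cotSum_sub_cotSumTruncation_sign hp (2 * n + 1)
    rw [Odd.neg_one_pow ⟨n, rfl⟩] at h0
    rw [Even.neg_one_pow ⟨n + 1, by ring⟩] at h1
    constructor <;> linarith
  refine ⟨fun m hm => pi_mul_cotSum_expansion hp hm, hb, ?_, ?_⟩
  · have h := (hb 0).1
    simp [cotSumTruncation] at h ⊢
    linarith
  -- With `b_2 = 1/6`, the single term of the truncation is `-2π · (1/36)/2 = -π/36`.
  · have h := (hb 0).2
    norm_num [cotSumTruncation, bernoulli_two] at h ⊢
    linarith
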